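/- Let $N\ge 0$ be an integer and let $T$ be the finite dyadic tree of depth $N$, whose nodes are the dyadic subintervals of $[0,1]$ of lengths $2^{-n}$, $0\le n\le N$. Let $T^2=T\times T$ be the bi-tree; its node $\alpha$ is identified with a dyadic rectangle $R_\alpha\subset[0,1]^2$, and $\alpha\le\beta$ means $R_\alpha\subset R_\beta$. The boundary $\partial T^2$ consists of the nodes whose rectangles are the squares of side length $2^{-N}$. A measure $\mu$ on $\partial T^2$ is a function $\mu\colon\partial T^2\to[0,\infty)$; put $\mu(E)=\sum_{\omega\in E}\mu(\omega)$ for $E\subset\partial T^2$ and, for $\alpha\in T^2$, $(\mu|E)(R_\alpha)=\sum_{\omega\in E,\ \omega\le\alpha}\mu(\omega)$. For $\varphi\colon T^2\to\mathbb R$ let $\mathbb I\varphi(\alpha)=\sum_{\beta\ge\alpha}\varphi(\beta)$ and $\|\varphi\|_{\ell^2(T^2)}^2=\sum_{\alpha\in T^2}|\varphi(\alpha)|^2$. For a real number $C$, say that $\mu$ satisfies the restricted energy condition $\mathrm{REC}(C)$ if $$\sum_{\alpha\in T^2}\big((\mu|E)(R_\alpha)\big)^2\le C\,\mu(E)\qquad\text{for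 all }E\subset\partial T^2,$$ and that $\mu$ satisfies the embedding with constant $C$ if $$\sum_{\omega\in\partial T^2}|\mathbb I\varphi(\omega)|^2\mu(\omega)\le C\,\|\varphi\|^2_{\ell^2(T^2)}\qquad\text{for all }\varphi\colon T^2\to\mathbb R.$$ Theorem. (i) For every $C$ there is a constant $C_1$, depending only on $C$ (and not on $N$ or $\mu$), such that for every $N$ every measure $\mu$ on $\partial T^2$ that satisfies $\mathrm{REC}(C)$ satisfies the embedding with constant $C_1$. (ii) Conversely, for every $C$, every $N$ and every measure $\mu$ on $\partial T^2$, if $\mu$ satisfies the embedding with constant $C$, then it satisfies $\mathrm{REC}(C)$. -/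

import Mathlib

/-- The finite dyadic tree `T` of depth `N`: a node is a pair `(n, k)` with `0 ≤ n ≤ N` and
`0 ≤ k < 2 ^ n`, standing for the dyadic interval `[k / 2 ^ n, (k + 1) / 2 ^ n]` of `[0, 1]`. -/
def DyadicTree (N : ℕ) : Type := Σ n : Fin (N + 1), Fin (2 ^ (n : ℕ))

namespace DyadicTree

instance (N : ℕ) : Fintype (DyadicTree N) :=
  inferInstanceAs (Fintype (Σ n : Fin (N + 1), Fin (2 ^ (n : ℕ))))

instance (N : ℕ) : DecidableEq (DyadicTree N) :=
  inferInstanceAs (DecidableEq (Σ n : Fin (N + 1), Fin (2 ^ (n : ℕ))))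

/-- The generation `n` of a node: its dyadic interval has length `2 ^ (-n)`. -/
def level {N : ℕ} (a : DyadicTree N) : ℕ := a.1

/-- The position of a node among the `2 ^ n` nodes of its generation. -/
def index {N : ℕ} (a : DyadicTree N) : ℕ := a.2

/-- The dyadic subinterval of `[0, 1]` identified with a node. -/
def interval {N : ℕ} (a : DyadicTree N) : Set ℝ :=
  Set.Icc ((a.index : ℝ) / 2 ^ a.level) (((a.index : ℝ) + 1) / 2 ^ a.level)

end DyadicTree

/-- The bi-tree `T² = T × T` of depth `N`. -/
def BiTree (N : ℕ) : Type := DyadicTree N × DyadicTree N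

namespace BiTree

instance (N : ℕ) : Fintype (BiTree N) :=
  inferInstanceAs (Fintype (DyadicTree N × DyadicTree N))

instance (N : ℕ) : DecidableEq (BiTree N) :=
  inferInstanceAs (DecidableEq (DyadicTree N × DyadicTree N))

/-- The dyadic rectangle `R_α ⊆ [0, 1]²` identified with a node `α` of the bi-tree. -/
def rect {N : ℕ} (α : BiTree N) : Set (ℝ × ℝ) := α.1.interval ×ˢ α.2.interval

/-- `α ≤ β` if and only if `R_α ⊆ R_β`. -/
instance (N : ℕ) : LE (BiTree N) := ⟨fun α β => α.rect ⊆ β.rect⟩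

/-- The boundary `∂T²`: the nodes whose rectangle is a square of side length `2 ^ (-N)`. -/
def boundary (N : ℕ) : Finset (BiTree N) :=
  Finset.univ.filter fun ω => ω.1.level = N ∧ ω.2.level = N

open Classical in
/-- The Hardy operator `𝕀 φ (α) = ∑_{β ≥ α} φ(β)`. -/
noncomputable def hardy {N : ℕ} (φ : BiTree N → ℝ) (α : BiTree N) : ℝ :=
  ∑ β ∈ Finset.univ.filter (fun β => α ≤ β), φ β

open Classical in
/-- The dual Hardy operator `𝕀* ψ (α) = ∑_{β ≤ α} ψ(β)`. -/
noncomputable def hardyDual {N : ℕ} (ψ : BiTree N → ℝ) (α : BiTree N) : ℝ :=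
  ∑ β ∈ Finset.univ.filter (fun β => β ≤ α), ψ β

/-- The square of the norm of `ℓ²(T²)`. -/
noncomputable def normSq {N : ℕ} (φ : BiTree N → ℝ) : ℝ := ∑ α, |φ α| ^ 2

end BiTree

/-- A (nonnegative, finite) measure on `∂T²`, given by the mass of each small square `R_ω`
and extended by zero to the nodes of `T²` that are not in the boundary. -/
structure BoundaryMeasure (N : ℕ) where
  mass : BiTree N → ℝ
  mass_nonneg : ∀ α, 0 ≤ mass α
  mass_eq_zero : ∀ α, α ∉ BiTree.boundary N → mass α = 0

namespace BoundaryMeasure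

variable {N : ℕ}

/-- `μ(E) = ∑_{ω ∈ E} μ(ω)` for `E ⊆ ∂T²`. -/
def measure (μ : BoundaryMeasure N) (E : Finset (BiTree N)) : ℝ := ∑ ω ∈ E, μ.mass ω

/-- `μ(R_α)`, the sum of `μ(ω)` over the boundary squares `R_ω ⊆ R_α`, that is `(𝕀* μ)(α)`. -/
noncomputable def rectMass (μ : BoundaryMeasure N) (α : BiTree N) : ℝ :=
  BiTree.hardyDual μ.mass α

/-- The restriction `μ|E`. -/
def restrict (μ : BoundaryMeasure N) (E : Finset (BiTree N)) : BoundaryMeasure N where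
  mass ω := if ω ∈ E then μ.mass ω else 0
  mass_nonneg ω := by
    split_ifs
    · exact μ.mass_nonneg ω
    · exact le_rfl
  mass_eq_zero ω hω := by
    split_ifs
    · exact μ.mass_eq_zero ω hω
    · rfl

/-- The energy `𝓔[μ] = ∑_{α ∈ T²} μ(R_α)² = ‖𝕀* μ‖²`. -/
noncomputable def energy (μ : BoundaryMeasure N) : ℝ := ∑ α, μ.rectMass α ^ 2

/-- The restricted energy condition with constant `C`:
`𝓔[μ|E] ≤ C μ(E)` for all `E ⊆ ∂T²`. -/
def RestrictedEnergy (μ : BoundaryMeasure N) (C : ℝ) : Prop :=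
  ∀ E ⊆ BiTree.boundary N, (μ.restrict E).energy ≤ C * μ.measure E

/-- The embedding of the Hardy operator with constant `C`:
`∑_{ω ∈ ∂T²} |𝕀 φ(ω)|² μ(ω) ≤ C ‖φ‖²` for all `φ : T² → ℝ`. -/
def Embedding (μ : BoundaryMeasure N) (C : ℝ) : Prop :=
  ∀ φ : BiTree N → ℝ,
    ∑ ω ∈ BiTree.boundary N, |BiTree.hardy φ ω| ^ 2 * μ.mass ω ≤ C * BiTree.normSq φ

end BoundaryMeasure

/-! ### Potentials on a product of two tree-like orders. -/

section OrderKernel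

/-! Write `I` for summation over all pairs above, `I*` for summation over all pairs below, and `I₁`,
`I₂` for summation upwards in one coordinate. By duality the embedding says that `‖I*(ψμ)‖²` is
bounded by a multiple of `∫ ψ² dμ`; the restricted energy condition is the case of indicators `ψ`.
The converse (ii) is therefore one application of Cauchy–Schwarz (`biEnergy_le_of_embedding`). For
(i), a density `ψ ≥ 0` is cut into level sets `E k` on which `16^k ≤ ψ < 16^(k+1)`. The weighted
bilinear energies of `E j` and `E k` decay like `2^(-|k-j|)` (`zpow_mul_biEnergy_le`), so Schur's
test sums them.

The decay comes from splitting `I*ν`, with `ν = μ|E`, according to the size of the potential `V = I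
I*ν`. Where `V > ε`, `I*ν` is dominated by `I*` of `μ` restricted to `E ∩ {V > ε}`, a set of small
mass by Chebyshev (`sqrt_sum_sq_sub_lowPart_le`). Where `V ≤ ε` remains the low part `g`. In a
single tree one would have `I g ≤ ε` everywhere; in a product this argument fails, since elements
above a common one need not be comparable.

The replacement is `sum_lowPart_mul_biDownSum_le`. Comparability in each coordinate gives `(I g)² ≤
2 I(g · I g) + 2 I(I₁g · I₂g)`, and `g · I g ≤ ε g`, so `I g ≤ l + (4/l) I(I₁g · I₂g)` when `4ε ≤
l`. The one-dimensional maximum principle, applied in each coordinate separately, yields `‖I₁g ·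
I₂g‖ ≤ 2ε ‖g‖`. Paired with another restriction of `μ`, the excess over the level `l` thus costs
only a factor `8ε/l` times the two energy norms. -/

open Classical in
/-- The zeta function of a preorder, with real values. -/
noncomputable def zetaKernel {X : Type*} [Preorder X] (x y : X) : ℝ := if x ≤ y then 1 else 0

/-- Any two elements with a common lower bound are comparable. -/
def UpTotal (X : Type*) [Preorder X] : Prop := ∀ w a b : X, w ≤ a → w ≤ b → a ≤ b ∨ b ≤ a

variable {X Y : Type*} [Preorder X] [Preorder Y]

lemma zetaKernel_nonneg (x y : X) : 0 ≤ zetaKernel x y := by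
  unfold zetaKernel; split_ifs <;> norm_num

lemma zetaKernel_mul_le (x y z : X) :
    zetaKernel x y * zetaKernel y z ≤ zetaKernel x y * zetaKernel x z := by
  unfold zetaKernel
  by_cases h : x ≤ y
  · by_cases h' : y ≤ z
    · simp [h, h', h.trans h']
    · simp only [h, h', if_true, if_false]; split_ifs <;> norm_num
  · simp [h]

lemma UpTotal.zetaKernel_le (hX : UpTotal X) (w a b : X) :
    zetaKernel w a * zetaKernel w b ≤
      zetaKernel w a * zetaKernel a b + zetaKernel w b * zetaKernel b a := by
  unfold zetaKernel
  by_cases h : w ≤ a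
  · by_cases h' : w ≤ b
    · rcases hX w a b h h' with h1 | h1
      · simp only [h, h', h1, if_true]; split_ifs <;> norm_num
      · simp only [h, h', h1, if_true]; split_ifs <;> norm_num
    · simp only [h, h', if_true, if_false]; split_ifs <;> norm_num
  · simp only [h, if_false]; split_ifs <;> norm_num

lemma zetaKernel_le_of_le {x x' : X} (h : x ≤ x') (a : X) :
    zetaKernel x' a ≤ zetaKernel x a := by
  unfold zetaKernel
  by_cases h' : x' ≤ a
  · simp [h', h.trans h']
  · simp only [h', if_false]; split_ifs <;> norm_num

lemma sum_sum_sum_sum_comm {I J K L : Type*} (s : Finset I) (t : Finset J) (u : Finset K)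
    (v : Finset L) (F : I → J → K → L → ℝ) :
    ∑ i ∈ s, ∑ j ∈ t, ∑ k ∈ u, ∑ l ∈ v, F i j k l =
      ∑ k ∈ u, ∑ l ∈ v, ∑ i ∈ s, ∑ j ∈ t, F i j k l := by
  have h : ∑ p ∈ s ×ˢ t, ∑ q ∈ u ×ˢ v, F p.1 p.2 q.1 q.2 =
      ∑ q ∈ u ×ˢ v, ∑ p ∈ s ×ˢ t, F p.1 p.2 q.1 q.2 := Finset.sum_comm
  simpa only [Finset.sum_product] using h

lemma sum_mul_le_sqrt_mul_sqrt {I J : Type*} [Fintype I] [Fintype J] (f g : I → J → ℝ) :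
    ∑ x, ∑ y, f x y * g x y ≤
      √(∑ x, ∑ y, f x y ^ 2) * √(∑ x, ∑ y, g x y ^ 2) := by
  simp only [← Fintype.sum_prod_type']
  exact Real.sum_mul_le_sqrt_mul_sqrt _ _ _

variable [Fintype X] [Fintype Y]

/-- The sum over the elements above a given one. -/
noncomputable def upSum (h : X → ℝ) (x : X) : ℝ := ∑ a, zetaKernel x a * h a

/-- The sum over the pairs above a given pair. -/
noncomputable def biUpSum (g : X → Y → ℝ) (x : X) (y : Y) : ℝ :=
  ∑ a, ∑ b, zetaKernel x a * zetaKernel y b * g a b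

/-- The sum over the pairs below a given pair. -/
noncomputable def biDownSum (g : X → Y → ℝ) (x : X) (y : Y) : ℝ :=
  ∑ a, ∑ b, zetaKernel a x * zetaKernel b y * g a b

/-- The sum over the pairs above a given pair with the same second coordinate. -/
noncomputable def fstUpSum (g : X → Y → ℝ) (x : X) (y : Y) : ℝ := upSum (fun a => g a y) x

/-- The sum over the pairs above a given pair with the same first coordinate. -/
noncomputable def sndUpSum (g : X → Y → ℝ) (x : X) (y : Y) : ℝ := upSum (fun b => g x b) y

lemma upSum_nonneg {h : X → ℝ} (hh : ∀ x, 0 ≤ h x) (x : X) : 0 ≤ upSum h x :=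
  Finset.sum_nonneg fun a _ => mul_nonneg (zetaKernel_nonneg x a) (hh a)

lemma biUpSum_nonneg {g : X → Y → ℝ} (hg : ∀ x y, 0 ≤ g x y) (x : X) (y : Y) :
    0 ≤ biUpSum g x y :=
  Finset.sum_nonneg fun a _ => Finset.sum_nonneg fun b _ =>
    mul_nonneg (mul_nonneg (zetaKernel_nonneg x a) (zetaKernel_nonneg y b)) (hg a b)

lemma biDownSum_nonneg {g : X → Y → ℝ} (hg : ∀ x y, 0 ≤ g x y) (x : X) (y : Y) :
    0 ≤ biDownSum g x y :=
  Finset.sum_nonneg fun a _ => Finset.sum_nonneg fun b _ =>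
    mul_nonneg (mul_nonneg (zetaKernel_nonneg a x) (zetaKernel_nonneg b y)) (hg a b)

lemma biUpSum_mono {g g' : X → Y → ℝ} (hg : ∀ x y, g x y ≤ g' x y) (x : X) (y : Y) :
    biUpSum g x y ≤ biUpSum g' x y :=
  Finset.sum_le_sum fun a _ => Finset.sum_le_sum fun b _ =>
    mul_le_mul_of_nonneg_left (hg a b)
      (mul_nonneg (zetaKernel_nonneg x a) (zetaKernel_nonneg y b))

lemma biDownSum_mono {g g' : X → Y → ℝ} (hg : ∀ x y, g x y ≤ g' x y) (x : X) (y : Y) :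
    biDownSum g x y ≤ biDownSum g' x y :=
  Finset.sum_le_sum fun a _ => Finset.sum_le_sum fun b _ =>
    mul_le_mul_of_nonneg_left (hg a b)
      (mul_nonneg (zetaKernel_nonneg a x) (zetaKernel_nonneg b y))

lemma biUpSum_antitone {g : X → Y → ℝ} (hg : ∀ x y, 0 ≤ g x y) {x x' : X} {y y' : Y}
    (hx : x ≤ x') (hy : y ≤ y') : biUpSum g x' y' ≤ biUpSum g x y :=
  Finset.sum_le_sum fun a _ => Finset.sum_le_sum fun b _ =>
    mul_le_mul_of_nonneg_right
      (mul_le_mul (zetaKernel_le_of_le hx a) (zetaKernel_le_of_le hy b)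
        (zetaKernel_nonneg _ _) (zetaKernel_nonneg _ _)) (hg a b)

lemma biUpSum_eq_upSum_sndUpSum (g : X → Y → ℝ) (x : X) (y : Y) :
    biUpSum g x y = upSum (fun a => sndUpSum g a y) x := by
  simp only [biUpSum, upSum, sndUpSum, Finset.mul_sum, mul_assoc]

lemma biUpSum_swap (g : X → Y → ℝ) (x : X) (y : Y) :
    biUpSum (fun y x => g x y) y x = biUpSum g x y := by
  unfold biUpSum
  rw [Finset.sum_comm]
  simp only [mul_comm (zetaKernel y _)]

lemma biDownSum_swap (g : X → Y → ℝ) (x : X) (y : Y) :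
    biDownSum (fun y x => g x y) y x = biDownSum g x y := by
  unfold biDownSum
  rw [Finset.sum_comm]
  simp only [mul_comm (zetaKernel _ y)]

lemma sum_biUpSum_mul (g ρ : X → Y → ℝ) :
    ∑ x, ∑ y, biUpSum g x y * ρ x y = ∑ x, ∑ y, g x y * biDownSum ρ x y := by
  simp only [biUpSum, biDownSum, Finset.mul_sum, Finset.sum_mul]
  rw [sum_sum_sum_sum_comm]
  exact Finset.sum_congr rfl fun a _ => Finset.sum_congr rfl fun b _ =>
    Finset.sum_congr rfl fun x _ => Finset.sum_congr rfl fun y _ => by ring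

/-- In the expanded square any two indices lie above `x`, hence are comparable; each of the two
orderings contributes one copy of the right-hand sum. -/
lemma sq_upSum_le (hX : UpTotal X) {h : X → ℝ} (hh : ∀ x, 0 ≤ h x) (x : X) :
    upSum h x ^ 2 ≤ 2 * upSum (fun a => h a * upSum h a) x := by
  have e : upSum (fun a => h a * upSum h a) x =
      ∑ a, ∑ b, zetaKernel x a * zetaKernel a b * (h a * h b) := by
    simp only [upSum, Finset.mul_sum]
    exact Finset.sum_congr rfl fun p _ => Finset.sum_congr rfl fun q _ => by ring
  have e' : upSum (fun a => h a * upSum h a) x =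
      ∑ a, ∑ b, zetaKernel x b * zetaKernel b a * (h a * h b) := by
    rw [e, Finset.sum_comm]
    exact Finset.sum_congr rfl fun p _ => Finset.sum_congr rfl fun q _ => by ring
  rw [two_mul]
  nth_rw 1 [e]
  rw [e', ← Finset.sum_add_distrib, sq, upSum, Finset.sum_mul_sum]
  refine Finset.sum_le_sum fun a _ => ?_
  rw [← Finset.sum_add_distrib]
  refine Finset.sum_le_sum fun b _ => ?_
  have := mul_le_mul_of_nonneg_right (hX.zetaKernel_le x a b) (mul_nonneg (hh a) (hh b))
  linarith

/-- The mixed term collects the pairs `a`, `b` whose coordinates are ordered oppositely; the point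
of summation on the left is the corner `(a.1, b.2)`. -/
lemma biUpSum_fstUpSum_mul_sndUpSum (g : X → Y → ℝ) (x : X) (y : Y) :
    biUpSum (fun a b => fstUpSum g a b * sndUpSum g a b) x y =
      ∑ a : X × Y, ∑ b : X × Y, zetaKernel x a.1 * zetaKernel a.1 b.1 *
        (zetaKernel y b.2 * zetaKernel b.2 a.2) * (g a.1 a.2 * g b.1 b.2) := by
  simp only [Fintype.sum_prod_type, biUpSum, fstUpSum, sndUpSum, upSum]
  refine Finset.sum_congr rfl fun a _ => ?_
  have : ∀ c : Y, (∑ b : X, ∑ d : Y, zetaKernel x a * zetaKernel a b *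
        (zetaKernel y d * zetaKernel d c) * (g a c * g b d)) =
      ∑ d : Y, ∑ b : X, zetaKernel x a * zetaKernel a b *
        (zetaKernel y d * zetaKernel d c) * (g a c * g b d) := fun c => Finset.sum_comm
  simp only [this]
  rw [Finset.sum_comm]
  refine Finset.sum_congr rfl fun d _ => ?_
  rw [Finset.sum_mul_sum, Finset.mul_sum, Finset.sum_comm]
  simp only [Finset.mul_sum]
  rw [Finset.sum_comm]
  refine (Finset.sum_comm).trans ?_
  exact Finset.sum_congr rfl fun c _ => Finset.sum_congr rfl fun b _ => by ring

/-- Two pairs above `(x, y)` are comparable in each coordinate, which leaves four patterns: the two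
concordant ones give `g * I g`, the two discordant ones give the mixed term. -/
lemma sq_biUpSum_le (hX : UpTotal X) (hY : UpTotal Y) {g : X → Y → ℝ}
    (hg : ∀ x y, 0 ≤ g x y) (x : X) (y : Y) :
    biUpSum g x y ^ 2 ≤ 2 * biUpSum (fun a b => g a b * biUpSum g a b) x y +
      2 * biUpSum (fun a b => fstUpSum g a b * sndUpSum g a b) x y := by
  have e1 : biUpSum (fun a b => g a b * biUpSum g a b) x y =
      ∑ a : X × Y, ∑ b : X × Y, zetaKernel x a.1 * zetaKernel a.1 b.1 *
        (zetaKernel y a.2 * zetaKernel a.2 b.2) * (g a.1 a.2 * g b.1 b.2) := by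
    simp only [biUpSum, Finset.mul_sum, Fintype.sum_prod_type]
    exact Finset.sum_congr rfl fun a _ => Finset.sum_congr rfl fun b _ =>
      Finset.sum_congr rfl fun x _ => Finset.sum_congr rfl fun y _ => by ring
  have e2 : biUpSum (fun a b => g a b * biUpSum g a b) x y =
      ∑ a : X × Y, ∑ b : X × Y, zetaKernel x b.1 * zetaKernel b.1 a.1 *
        (zetaKernel y b.2 * zetaKernel b.2 a.2) * (g a.1 a.2 * g b.1 b.2) := by
    rw [e1, Finset.sum_comm]
    exact Finset.sum_congr rfl fun p _ => Finset.sum_congr rfl fun q _ => by ring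
  have e3 := biUpSum_fstUpSum_mul_sndUpSum g x y
  have e4 : biUpSum (fun a b => fstUpSum g a b * sndUpSum g a b) x y =
      ∑ a : X × Y, ∑ b : X × Y, zetaKernel x b.1 * zetaKernel b.1 a.1 *
        (zetaKernel y a.2 * zetaKernel a.2 b.2) * (g a.1 a.2 * g b.1 b.2) := by
    rw [e3, Finset.sum_comm]
    exact Finset.sum_congr rfl fun p _ => Finset.sum_congr rfl fun q _ => by ring
  rw [two_mul, two_mul]
  nth_rw 1 [e1]
  rw [e2]
  nth_rw 1 [e3]
  rw [e4]
  have e5 : biUpSum g x y =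
      ∑ a : X × Y, zetaKernel x a.1 * zetaKernel y a.2 * g a.1 a.2 := by
    rw [Fintype.sum_prod_type]; rfl
  rw [e5, sq, Finset.sum_mul_sum]
  simp only [← Finset.sum_add_distrib]
  refine Finset.sum_le_sum fun a _ => Finset.sum_le_sum fun b _ => ?_
  have h1 := hX.zetaKernel_le x a.1 b.1
  have h2 := hY.zetaKernel_le y a.2 b.2
  have h3 := mul_le_mul h1 h2
    (mul_nonneg (zetaKernel_nonneg _ _) (zetaKernel_nonneg _ _))
    ((mul_nonneg (zetaKernel_nonneg _ _) (zetaKernel_nonneg _ _)).trans h1)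
  have h4 := mul_le_mul_of_nonneg_right h3 (mul_nonneg (hg a.1 a.2) (hg b.1 b.2))
  linarith

/-! ### The region of small potential and the maximum principle in one coordinate. -/

open Classical in
-- The maximum principle in one tree: the elements of `S` above `w` form a chain, and the full sum
-- taken from a minimal one already covers all of them.
lemma UpTotal.upSum_indicator_le (hX : UpTotal X) {h : X → ℝ} (hh : ∀ x, 0 ≤ h x)
    {S : X → Prop} {ε : ℝ} (hε : 0 ≤ ε) (hS : ∀ x, S x → upSum h x ≤ ε) (w : X) :
    upSum (fun x => if S x then h x else 0) w ≤ ε := by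
  by_cases hne : {x | w ≤ x ∧ S x}.Nonempty
  · obtain ⟨x₀, hx₀⟩ := (Set.toFinite {x | w ≤ x ∧ S x}).exists_minimal hne
    refine le_trans ?_ (hS x₀ hx₀.1.2)
    refine Finset.sum_le_sum fun a _ => ?_
    by_cases ha : w ≤ a ∧ S a
    · have hle : x₀ ≤ a := by
        rcases hX w x₀ a hx₀.1.1 ha.1 with h1 | h1
        · exact h1
        · exact hx₀.2 ha h1
      simp [zetaKernel, ha.1, ha.2, hle]
    · have : zetaKernel w a * (if S a then h a else 0) = 0 := by
        by_cases h1 : w ≤ a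
        · rw [if_neg fun h2 => ha ⟨h1, h2⟩, mul_zero]
        · simp [zetaKernel, h1]
      rw [this]
      exact mul_nonneg (zetaKernel_nonneg _ _) (hh a)
  · refine le_trans (le_of_eq ?_) hε
    refine Finset.sum_eq_zero fun a _ => ?_
    by_cases h1 : w ≤ a
    · beta_reduce; rw [if_neg fun h2 => hne ⟨a, h1, h2⟩, mul_zero]
    · simp [zetaKernel, h1]

open Classical in
lemma UpTotal.sum_downSum_mul_le (hX : UpTotal X) {h ν : X → ℝ} (hh : ∀ x, 0 ≤ h x)
    (hν : ∀ x, 0 ≤ ν x) {S : X → Prop} {ε : ℝ} (hε : 0 ≤ ε) (hS : ∀ x, S x → upSum h x ≤ ε)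
    (a : X) :
    ∑ x, zetaKernel x a * ((∑ u, zetaKernel u x * ν u) * (if S x then h x else 0)) ≤
      ε * ∑ u, zetaKernel u a * ν u := by
  have e : ∀ x, zetaKernel x a * ((∑ u, zetaKernel u x * ν u) * (if S x then h x else 0)) =
      ∑ u, zetaKernel u x * zetaKernel x a * (ν u * (if S x then h x else 0)) := by
    intro x
    rw [Finset.sum_mul, Finset.mul_sum]
    exact Finset.sum_congr rfl fun u _ => by ring
  simp only [e]
  rw [Finset.sum_comm, Finset.mul_sum]
  refine Finset.sum_le_sum fun u _ => ?_
  have h0 : ∀ x, 0 ≤ (if S x then h x else 0) := fun x => by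
    split_ifs
    · exact hh x
    · exact le_rfl
  -- From `u ≤ x ≤ a` only `u ≤ a` is kept, so that `x` runs freely over the elements above `u`.
  calc ∑ x, zetaKernel u x * zetaKernel x a * (ν u * (if S x then h x else 0))
      ≤ ∑ x, zetaKernel u x * zetaKernel u a * (ν u * (if S x then h x else 0)) :=
        Finset.sum_le_sum fun x _ =>
          mul_le_mul_of_nonneg_right (zetaKernel_mul_le u x a) (mul_nonneg (hν u) (h0 x))
    _ = upSum (fun x => if S x then h x else 0) u * (zetaKernel u a * ν u) := by
        rw [upSum, Finset.sum_mul]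
        exact Finset.sum_congr rfl fun x _ => by ring
    _ ≤ ε * (zetaKernel u a * ν u) :=
        mul_le_mul_of_nonneg_right (hX.upSum_indicator_le hh hε hS u)
          (mul_nonneg (zetaKernel_nonneg _ _) (hν u))

open Classical in
/-- The part of `biDownSum ν` where its potential is at most `ε`. -/
noncomputable def lowPart (ν : X → Y → ℝ) (ε : ℝ) (x : X) (y : Y) : ℝ :=
  if biUpSum (biDownSum ν) x y ≤ ε then biDownSum ν x y else 0

lemma lowPart_nonneg {ν : X → Y → ℝ} (hν : ∀ x y, 0 ≤ ν x y) (ε : ℝ) (x : X) (y : Y) :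
    0 ≤ lowPart ν ε x y := by
  unfold lowPart
  split_ifs
  · exact biDownSum_nonneg hν x y
  · exact le_rfl

lemma lowPart_le {ν : X → Y → ℝ} (hν : ∀ x y, 0 ≤ ν x y) (ε : ℝ) (x : X) (y : Y) :
    lowPart ν ε x y ≤ biDownSum ν x y := by
  unfold lowPart
  split_ifs
  · exact le_rfl
  · exact biDownSum_nonneg hν x y

lemma lowPart_swap (ν : X → Y → ℝ) (ε : ℝ) (x : X) (y : Y) :
    lowPart (fun y x => ν x y) ε y x = lowPart ν ε x y := by
  have : biDownSum (fun y x => ν x y) = fun y x => biDownSum ν x y :=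
    funext fun y => funext fun x => biDownSum_swap ν x y
  unfold lowPart
  rw [this, biUpSum_swap]

lemma biUpSum_lowPart_le {ν : X → Y → ℝ} (hν : ∀ x y, 0 ≤ ν x y) {ε : ℝ} {x : X} {y : Y}
    (h : biUpSum (biDownSum ν) x y ≤ ε) : biUpSum (lowPart ν ε) x y ≤ ε :=
  (biUpSum_mono (lowPart_le hν ε) x y).trans h

/-- With `b` frozen this is a one-tree statement: `I₂g(·, b)` has upward sum `I g(·, b)`, which is
at most `ε` on the low region. -/
lemma sum_lowPart_mul_sndUpSum_le (hX : UpTotal X) {ν : X → Y → ℝ} (hν : ∀ x y, 0 ≤ ν x y)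
    {ε : ℝ} (hε : 0 ≤ ε) (a : X) (b : Y) :
    ∑ x, zetaKernel x a * (lowPart ν ε x b * sndUpSum (lowPart ν ε) x b) ≤
      ε * lowPart ν ε a b := by
  classical
  by_cases hab : biUpSum (biDownSum ν) a b ≤ ε
  -- The measure on the first tree is the marginal of `ν` over the second coordinates below `b`; its
  -- downward sum is `biDownSum ν · b`.
  · have h1 := hX.sum_downSum_mul_le (h := fun x => sndUpSum (lowPart ν ε) x b)
      (ν := fun u => ∑ v, zetaKernel v b * ν u v)
      (S := fun x => biUpSum (biDownSum ν) x b ≤ ε)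
      (fun x => upSum_nonneg (fun y => lowPart_nonneg hν ε x y) b)
      (fun u => Finset.sum_nonneg fun v _ => mul_nonneg (zetaKernel_nonneg _ _) (hν u v))
      hε (fun x hx => by
        rw [← biUpSum_eq_upSum_sndUpSum]; exact biUpSum_lowPart_le hν hx) a
    have h2 : ∀ x, ∑ u, zetaKernel u x * ∑ v, zetaKernel v b * ν u v = biDownSum ν x b := by
      intro x
      simp only [biDownSum, Finset.mul_sum, mul_assoc]
    simp only [h2] at h1
    have h3 : lowPart ν ε a b = biDownSum ν a b := by simp [lowPart, hab]
    rw [h3]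
    refine le_trans (le_of_eq (Finset.sum_congr rfl fun x _ => ?_)) h1
    by_cases hx : biUpSum (biDownSum ν) x b ≤ ε
    · simp [lowPart, hx]
    · simp [lowPart, hx]
  · refine le_trans (le_of_eq ?_) (mul_nonneg hε (lowPart_nonneg hν ε a b))
    refine Finset.sum_eq_zero fun x _ => ?_
    by_cases hx : x ≤ a
    · have : ¬ biUpSum (biDownSum ν) x b ≤ ε := fun h =>
        hab ((biUpSum_antitone (biDownSum_nonneg hν) hx le_rfl).trans h)
      simp [lowPart, this]
    · simp [zetaKernel, hx]

lemma sum_lowPart_mul_fstUpSum_le (hY : UpTotal Y) {ν : X → Y → ℝ} (hν : ∀ x y, 0 ≤ ν x y)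
    {ε : ℝ} (hε : 0 ≤ ε) (a : X) (b : Y) :
    ∑ y, zetaKernel y b * (lowPart ν ε a y * fstUpSum (lowPart ν ε) a y) ≤
      ε * lowPart ν ε a b := by
  have h := sum_lowPart_mul_sndUpSum_le hY (ν := fun y x => ν x y) (fun y x => hν x y) hε b a
  simpa only [sndUpSum, fstUpSum, lowPart_swap] using h

/-- After `sq_upSum_le` in both factors, the sum is reorganised around the opposite corner `(a, b)`:
the factor from `I₁` is summed over `y ≤ b`, the one from `I₂` over `x ≤ a`, and each is at most `ε
* g a b`. -/
lemma sum_sq_fstUpSum_mul_sndUpSum_le (hX : UpTotal X) (hY : UpTotal Y) {ν : X → Y → ℝ}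
    (hν : ∀ x y, 0 ≤ ν x y) {ε : ℝ} (hε : 0 ≤ ε) :
    ∑ x, ∑ y, (fstUpSum (lowPart ν ε) x y * sndUpSum (lowPart ν ε) x y) ^ 2 ≤
      4 * ε ^ 2 * ∑ x, ∑ y, lowPart ν ε x y ^ 2 := by
  set g := lowPart ν ε with hgdef
  have hg : ∀ x y, 0 ≤ g x y := lowPart_nonneg hν ε
  have hs : ∀ x y, 0 ≤ sndUpSum g x y := fun x y => upSum_nonneg (fun b => hg x b) y
  have step1 : ∀ x y, (fstUpSum g x y * sndUpSum g x y) ^ 2 ≤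
      ∑ a, ∑ b, 4 * ((zetaKernel y b * (g a y * fstUpSum g a y)) *
        (zetaKernel x a * (g x b * sndUpSum g x b))) := by
    intro x y
    have h1 : fstUpSum g x y ^ 2 ≤ 2 * ∑ a, zetaKernel x a * (g a y * fstUpSum g a y) :=
      sq_upSum_le hX (fun a => hg a y) x
    have h2 : sndUpSum g x y ^ 2 ≤ 2 * ∑ b, zetaKernel y b * (g x b * sndUpSum g x b) :=
      sq_upSum_le hY (fun b => hg x b) y
    rw [mul_pow]
    refine (mul_le_mul h1 h2 (sq_nonneg _) ((sq_nonneg _).trans h1)).trans (le_of_eq ?_)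
    rw [mul_mul_mul_comm, Finset.sum_mul_sum, Finset.mul_sum]
    refine Finset.sum_congr rfl fun a _ => ?_
    rw [Finset.mul_sum]
    exact Finset.sum_congr rfl fun b _ => by ring
  calc ∑ x, ∑ y, (fstUpSum g x y * sndUpSum g x y) ^ 2
      ≤ ∑ x, ∑ y, ∑ a, ∑ b, 4 * ((zetaKernel y b * (g a y * fstUpSum g a y)) *
        (zetaKernel x a * (g x b * sndUpSum g x b))) :=
        Finset.sum_le_sum fun x _ => Finset.sum_le_sum fun y _ => step1 x y
    _ = ∑ a, ∑ b, ∑ y, ∑ x, 4 * ((zetaKernel y b * (g a y * fstUpSum g a y)) *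
        (zetaKernel x a * (g x b * sndUpSum g x b))) := by
        rw [sum_sum_sum_sum_comm]
        exact Finset.sum_congr rfl fun a _ => Finset.sum_congr rfl fun b _ => Finset.sum_comm
    _ = ∑ a, ∑ b, 4 * ((∑ y, zetaKernel y b * (g a y * fstUpSum g a y)) *
        (∑ x, zetaKernel x a * (g x b * sndUpSum g x b))) := by
        refine Finset.sum_congr rfl fun a _ => Finset.sum_congr rfl fun b _ => ?_
        rw [Finset.sum_mul_sum, Finset.mul_sum]
        simp only [Finset.mul_sum]
    _ ≤ ∑ a, ∑ b, 4 * ((ε * g a b) * (ε * g a b)) := by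
        refine Finset.sum_le_sum fun a _ => Finset.sum_le_sum fun b _ => ?_
        refine mul_le_mul_of_nonneg_left ?_ (by norm_num)
        refine mul_le_mul (sum_lowPart_mul_fstUpSum_le hY hν hε a b)
          (sum_lowPart_mul_sndUpSum_le hX hν hε a b) ?_ (mul_nonneg hε (hg a b))
        exact Finset.sum_nonneg fun x _ =>
          mul_nonneg (zetaKernel_nonneg _ _) (mul_nonneg (hg x b) (hs x b))
    _ = 4 * ε ^ 2 * ∑ x, ∑ y, g x y ^ 2 := by
        simp only [Finset.mul_sum]
        exact Finset.sum_congr rfl fun a _ => Finset.sum_congr rfl fun b _ => by ring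

lemma biUpSum_lowPart_le_add (hX : UpTotal X) (hY : UpTotal Y) {ν : X → Y → ℝ}
    (hν : ∀ x y, 0 ≤ ν x y) {ε l : ℝ} (hl : 0 < l) (hεl : 4 * ε ≤ l) (x : X) (y : Y) :
    biUpSum (lowPart ν ε) x y ≤ l + 4 / l *
      biUpSum (fun a b => fstUpSum (lowPart ν ε) a b * sndUpSum (lowPart ν ε) a b) x y := by
  set g := lowPart ν ε with hgdef
  have hg : ∀ x y, 0 ≤ g x y := lowPart_nonneg hν ε
  set Φ := biUpSum (fun a b => fstUpSum g a b * sndUpSum g a b) x y with hΦ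
  have hΦ0 : 0 ≤ Φ := biUpSum_nonneg
    (fun a b => mul_nonneg (upSum_nonneg (fun a => hg a b) a) (upSum_nonneg (fun b => hg a b) b)) x y
  rcases le_total (biUpSum g x y) l with h | h
  · have : 0 ≤ 4 / l * Φ := by positivity
    linarith
  · have h1 := sq_biUpSum_le hX hY hg x y
    have h2 : biUpSum (fun a b => g a b * biUpSum g a b) x y ≤ ε * biUpSum g x y := by
      have e : ε * biUpSum g x y = biUpSum (fun a b => g a b * ε) x y := by
        simp only [biUpSum, Finset.mul_sum]
        exact Finset.sum_congr rfl fun a _ => Finset.sum_congr rfl fun b _ => by ring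
      rw [e]
      refine biUpSum_mono (fun a b => ?_) x y
      by_cases hab : biUpSum (biDownSum ν) a b ≤ ε
      · exact mul_le_mul_of_nonneg_left (biUpSum_lowPart_le hν hab) (hg a b)
      · have : g a b = 0 := by simp [hgdef, lowPart, hab]
        simp [this]
    set v := biUpSum g x y
    -- Since `4ε ≤ l ≤ v`, the term `2εv` is at most `v² / 2` and is absorbed into the left side.
    have h3 : l * v ≤ 4 * Φ := by nlinarith
    have h4 : v ≤ 4 / l * Φ := by
      rw [div_mul_eq_mul_div, le_div_iff₀ hl]; linarith
    linarith

/-- The surrogate of the maximum principle for the potential of the low part. -/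
lemma sum_lowPart_mul_biDownSum_le (hX : UpTotal X) (hY : UpTotal Y) {ν ρ : X → Y → ℝ}
    (hν : ∀ x y, 0 ≤ ν x y) (hρ : ∀ x y, 0 ≤ ρ x y) {ε l : ℝ} (hε : 0 ≤ ε) (hl : 0 < l)
    (hεl : 4 * ε ≤ l) :
    ∑ x, ∑ y, lowPart ν ε x y * biDownSum ρ x y ≤ l * ∑ x, ∑ y, ρ x y +
      8 * ε / l * (√(∑ x, ∑ y, biDownSum ν x y ^ 2) * √(∑ x, ∑ y, biDownSum ρ x y ^ 2)) := by
  set φ : X → Y → ℝ := fun a b => fstUpSum (lowPart ν ε) a b * sndUpSum (lowPart ν ε) a b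
    with hφ
  have h1 : ∑ x, ∑ y, lowPart ν ε x y * biDownSum ρ x y ≤
      l * ∑ x, ∑ y, ρ x y + 4 / l * ∑ x, ∑ y, φ x y * biDownSum ρ x y := by
    rw [← sum_biUpSum_mul, ← sum_biUpSum_mul]
    simp only [Finset.mul_sum, ← Finset.sum_add_distrib]
    refine Finset.sum_le_sum fun x _ => Finset.sum_le_sum fun y _ => ?_
    have := mul_le_mul_of_nonneg_right (biUpSum_lowPart_le_add hX hY hν hl hεl x y) (hρ x y)
    linarith
  have h2 := sum_mul_le_sqrt_mul_sqrt φ (biDownSum ρ)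
  have h3 : √(∑ x, ∑ y, φ x y ^ 2) ≤ 2 * ε * √(∑ x, ∑ y, biDownSum ν x y ^ 2) := by
    rw [Real.sqrt_le_iff]
    refine ⟨by positivity, ?_⟩
    rw [mul_pow, Real.sq_sqrt (Finset.sum_nonneg fun x _ => Finset.sum_nonneg fun y _ =>
      sq_nonneg _)]
    refine (sum_sq_fstUpSum_mul_sndUpSum_le hX hY hν hε).trans ?_
    rw [mul_pow]
    norm_num
    refine mul_le_mul_of_nonneg_left ?_ (by positivity)
    exact Finset.sum_le_sum fun x _ => Finset.sum_le_sum fun y _ =>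
      pow_le_pow_left₀ (lowPart_nonneg hν ε x y) (lowPart_le hν ε x y) 2
  have h4 := h2.trans (mul_le_mul_of_nonneg_right h3 (Real.sqrt_nonneg _))
  have h5 := mul_le_mul_of_nonneg_left h4 (by positivity : 0 ≤ 4 / l)
  refine (h1.trans (add_le_add_right h5 _)).trans (le_of_eq ?_)
  ring

end OrderKernel

/-! ### Bilinear energies of restrictions under the restricted energy condition. -/

section RestrictedEnergy

variable {X Y : Type*}

open Classical in
/-- The restriction of a function of two variables to a set of pairs, extended by zero. -/
noncomputable def biRestrict (μ : X → Y → ℝ) (E : X → Y → Prop) (x : X) (y : Y) : ℝ :=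
  if E x y then μ x y else 0

lemma biRestrict_nonneg {μ : X → Y → ℝ} (hμ : ∀ x y, 0 ≤ μ x y) (E : X → Y → Prop)
    (x : X) (y : Y) : 0 ≤ biRestrict μ E x y := by
  unfold biRestrict
  split_ifs
  · exact hμ x y
  · exact le_rfl

variable [Fintype X] [Fintype Y]

/-- The total mass of the restriction of `μ` to `E`. -/
noncomputable def biMass (μ : X → Y → ℝ) (E : X → Y → Prop) : ℝ := ∑ x, ∑ y, biRestrict μ E x y

lemma biMass_nonneg {μ : X → Y → ℝ} (hμ : ∀ x y, 0 ≤ μ x y) (E : X → Y → Prop) :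
    0 ≤ biMass μ E :=
  Finset.sum_nonneg fun x _ => Finset.sum_nonneg fun y _ => biRestrict_nonneg hμ E x y

variable [Preorder X] [Preorder Y]

/-- The bilinear energy of the restrictions of `μ` to `E` and to `F`. -/
noncomputable def biEnergy (μ : X → Y → ℝ) (E F : X → Y → Prop) : ℝ :=
  ∑ x, ∑ y, biDownSum (biRestrict μ E) x y * biDownSum (biRestrict μ F) x y

lemma biEnergy_comm (μ : X → Y → ℝ) (E F : X → Y → Prop) :
    biEnergy μ E F = biEnergy μ F E := by
  simp only [biEnergy, mul_comm]

lemma biEnergy_self (μ : X → Y → ℝ) (E : X → Y → Prop) :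
    biEnergy μ E E = ∑ x, ∑ y, biDownSum (biRestrict μ E) x y ^ 2 := by
  simp only [biEnergy, sq]

lemma sqrt_biEnergy_le {μ : X → Y → ℝ} (hμ : ∀ x y, 0 ≤ μ x y) {C : ℝ} (hC : 1 ≤ C)
    (hR : ∀ E, biEnergy μ E E ≤ C * biMass μ E) (E : X → Y → Prop) :
    √(biEnergy μ E E) ≤ C * √(biMass μ E) := by
  have h0 := biMass_nonneg hμ E
  rw [Real.sqrt_le_iff]
  refine ⟨by positivity, (hR E).trans ?_⟩
  rw [mul_pow, Real.sq_sqrt h0]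
  exact mul_le_mul_of_nonneg_right (by nlinarith) h0

/-- The part of the energy that is carried by the region of large potential is small. -/
lemma sqrt_sum_sq_sub_lowPart_le {μ : X → Y → ℝ} (hμ : ∀ x y, 0 ≤ μ x y) {C : ℝ} (hC : 1 ≤ C)
    (hR : ∀ E, biEnergy μ E E ≤ C * biMass μ E) (E : X → Y → Prop) {r : ℝ} (hr : 0 < r) :
    √(∑ x, ∑ y, (biDownSum (biRestrict μ E) x y - lowPart (biRestrict μ E) (r ^ 2) x y) ^ 2) ≤
      C / r * √(biMass μ E) := by
  classical
  set ν := biRestrict μ E with hν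
  have hν0 : ∀ x y, 0 ≤ ν x y := biRestrict_nonneg hμ E
  -- Every point below a point of large potential again has large potential, so there `I*ν` only
  -- sees the mass of `ν` on `F`.
  set F : X → Y → Prop := fun x y => E x y ∧ r ^ 2 < biUpSum (biDownSum ν) x y with hF
  have hpt : ∀ x y, biDownSum ν x y - lowPart ν (r ^ 2) x y ≤ biDownSum (biRestrict μ F) x y := by
    intro x y
    unfold lowPart
    split_ifs with h
    · rw [sub_self]; exact biDownSum_nonneg (biRestrict_nonneg hμ F) x y
    · rw [sub_zero]
      refine Finset.sum_le_sum fun a _ => Finset.sum_le_sum fun b _ => ?_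
      by_cases ha : a ≤ x
      · by_cases hb : b ≤ y
        · have h1 : r ^ 2 < biUpSum (biDownSum ν) a b :=
            (not_le.1 h).trans_le (biUpSum_antitone (biDownSum_nonneg hν0) ha hb)
          have h2 : biRestrict μ F a b = ν a b := by
            by_cases hab : E a b
            · rw [biRestrict, if_pos (show F a b from ⟨hab, h1⟩), hν, biRestrict, if_pos hab]
            · rw [biRestrict, if_neg (fun h => hab h.1 : ¬ F a b), hν, biRestrict, if_neg hab]
          rw [h2]
        · simp [zetaKernel, hb]
      · simp [zetaKernel, ha]
  have h1 : ∑ x, ∑ y, (biDownSum ν x y - lowPart ν (r ^ 2) x y) ^ 2 ≤ C * biMass μ F := by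
    refine le_trans ?_ (hR F)
    rw [biEnergy_self]
    exact Finset.sum_le_sum fun x _ => Finset.sum_le_sum fun y _ =>
      pow_le_pow_left₀ (sub_nonneg.2 (lowPart_le hν0 _ x y)) (hpt x y) 2
  -- Chebyshev: the integral of the potential against `ν` is the energy of `ν`.
  have h2 : r ^ 2 * biMass μ F ≤ C * biMass μ E := by
    refine le_trans ?_ (hR E)
    have e : biEnergy μ E E = ∑ x, ∑ y, biUpSum (biDownSum ν) x y * ν x y := by
      rw [sum_biUpSum_mul]; rfl
    rw [e, biMass, Finset.mul_sum]
    refine Finset.sum_le_sum fun x _ => ?_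
    rw [Finset.mul_sum]
    refine Finset.sum_le_sum fun y _ => ?_
    by_cases h : F x y
    · have h3 : biRestrict μ F x y = ν x y := by simp [hν, biRestrict, h, h.1]
      rw [h3]
      exact mul_le_mul_of_nonneg_right h.2.le (hν0 x y)
    · have h3 : biRestrict μ F x y = 0 := by simp [biRestrict, h]
      rw [h3, mul_zero]
      exact mul_nonneg (biUpSum_nonneg (biDownSum_nonneg hν0) x y) (hν0 x y)
  rw [Real.sqrt_le_iff]
  refine ⟨by positivity, h1.trans ?_⟩
  rw [mul_pow, Real.sq_sqrt (biMass_nonneg hμ E), div_pow, div_mul_eq_mul_div, le_div_iff₀ (by positivity)]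
  nlinarith

/-- The threshold `ε = r²` and level `l = 4r³` make `8ε/l = 2/r`; the high part adds another `1/r`.
The main term involves the mass of `F` alone, and this asymmetry is what the decay between level
sets exploits. -/
lemma biEnergy_le (hX : UpTotal X) (hY : UpTotal Y) {μ : X → Y → ℝ} (hμ : ∀ x y, 0 ≤ μ x y)
    {C : ℝ} (hC : 1 ≤ C) (hR : ∀ E, biEnergy μ E E ≤ C * biMass μ E) (E F : X → Y → Prop)
    {r : ℝ} (hr : 1 ≤ r) :
    biEnergy μ E F ≤ 4 * r ^ 3 * biMass μ F +
      3 * C ^ 2 / r * (√(biMass μ E) * √(biMass μ F)) := by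
  have hr0 : 0 < r := by linarith
  set A := √(biMass μ E)
  set B := √(biMass μ F)
  have hlow := sum_lowPart_mul_biDownSum_le hX hY (biRestrict_nonneg hμ E)
    (biRestrict_nonneg hμ F) (sq_nonneg r) (by positivity : 0 < 4 * r ^ 3) (by nlinarith [sq_nonneg r])
  rw [← biEnergy_self, ← biEnergy_self] at hlow
  have hhigh := sum_mul_le_sqrt_mul_sqrt (fun x y => biDownSum (biRestrict μ E) x y -
    lowPart (biRestrict μ E) (r ^ 2) x y) (biDownSum (biRestrict μ F))
  rw [← biEnergy_self μ F] at hhigh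
  have hE := sqrt_biEnergy_le hμ hC hR E
  have hF := sqrt_biEnergy_le hμ hC hR F
  have hH := sqrt_sum_sq_sub_lowPart_le hμ hC hR E hr0
  have h1 := mul_le_mul hE hF (Real.sqrt_nonneg _) (by positivity)
  have h2 := hhigh.trans (mul_le_mul hH hF (Real.sqrt_nonneg _) (by positivity))
  have h3 := mul_le_mul_of_nonneg_left h1 (by positivity : 0 ≤ 8 * r ^ 2 / (4 * r ^ 3))
  have e : biEnergy μ E F = ∑ x, ∑ y, lowPart (biRestrict μ E) (r ^ 2) x y *
      biDownSum (biRestrict μ F) x y + ∑ x, ∑ y, (biDownSum (biRestrict μ E) x y -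
      lowPart (biRestrict μ E) (r ^ 2) x y) * biDownSum (biRestrict μ F) x y := by
    simp only [← Finset.sum_add_distrib, biEnergy]
    exact Finset.sum_congr rfl fun x _ => Finset.sum_congr rfl fun y _ => by ring
  rw [e]
  refine (add_le_add (hlow.trans (add_le_add_right h3 _)) h2).trans (le_of_eq ?_)
  rw [show ∑ x, ∑ y, biRestrict μ F x y = biMass μ F from rfl]
  field_simp
  ring

/-- Off-diagonal decay of the energies of two level sets. -/
lemma mul_biEnergy_le (hX : UpTotal X) (hY : UpTotal Y) {μ : X → Y → ℝ} (hμ : ∀ x y, 0 ≤ μ x y)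
    {C : ℝ} (hC : 1 ≤ C) (hR : ∀ E, biEnergy μ E E ≤ C * biMass μ E) (E F : X → Y → Prop)
    {r s : ℝ} (hr : 1 ≤ r) (hs : 0 ≤ s) :
    s * (s * r ^ 4) * biEnergy μ E F ≤
      6 * C ^ 2 / r * (s ^ 2 * biMass μ E + (s * r ^ 4) ^ 2 * biMass μ F) := by
  have hr0 : 0 < r := by linarith
  have h := mul_le_mul_of_nonneg_left (biEnergy_le hX hY hμ hC hR E F hr)
    (by positivity : 0 ≤ s * (s * r ^ 4))
  refine h.trans ?_
  have hE := biMass_nonneg hμ E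
  have hF := biMass_nonneg hμ F
  rw [← Real.sq_sqrt hE, ← Real.sq_sqrt hF, Real.sqrt_sq (Real.sqrt_nonneg _),
    Real.sqrt_sq (Real.sqrt_nonneg _)]
  set A := √(biMass μ E)
  set B := √(biMass μ F)
  set p := s * A
  set q := s * r ^ 4 * B
  -- The ratio `r⁴` of the weights is chosen so that `s * (s * r⁴) * r³ * B² = q² / r`: the main
  -- term gains the same `1/r` as the error.
  have e1 : s * (s * r ^ 4) * (4 * r ^ 3 * B ^ 2 + 3 * C ^ 2 / r * (A * B)) =
      (4 * q ^ 2 + 3 * C ^ 2 * (p * q)) / r := by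
    simp only [p, q]; field_simp
  have e2 : 6 * C ^ 2 / r * (s ^ 2 * A ^ 2 + (s * r ^ 4) ^ 2 * B ^ 2) =
      (6 * C ^ 2 * (p ^ 2 + q ^ 2)) / r := by
    simp only [p, q]; ring
  rw [e1, e2]
  refine div_le_div_of_nonneg_right ?_ hr0.le
  have hC2 : 1 ≤ C ^ 2 := by nlinarith
  nlinarith [mul_nonneg (sq_nonneg C) (sq_nonneg (p - q)), mul_nonneg (sub_nonneg.2 hC2) (sq_nonneg q),
    mul_nonneg (sq_nonneg C) (sq_nonneg p), mul_nonneg (sq_nonneg C) (sq_nonneg q)]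

end RestrictedEnergy

/-! ### Summation over level sets, and duality. -/

section DyadicLevels

/-- Closes both duality arguments, where Cauchy–Schwarz bounds a finite quantity by its own square
root. -/
lemma le_of_le_sqrt_mul {a b : ℝ} (ha : 0 ≤ a) (hb : 0 ≤ b) (h : a ≤ √(b * a)) : a ≤ b := by
  have h' := pow_le_pow_left₀ ha h 2
  rw [Real.sq_sqrt (mul_nonneg hb ha), sq] at h'
  rcases ha.eq_or_lt with h0 | h0
  · rwa [← h0]
  · exact le_of_mul_le_mul_right h' h0

lemma sum_half_pow_le_two {ι : Type*} {s : Finset ι} {f : ι → ℕ} (hf : Set.InjOn f s) :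
    ∑ i ∈ s, (1 / 2 : ℝ) ^ f i ≤ 2 := by
  classical
  rw [← Finset.sum_image (f := fun n => (1 / 2 : ℝ) ^ n) hf]
  exact (summable_geometric_two.sum_le_tsum _ fun n _ => by positivity).trans
    tsum_geometric_two.le

lemma sum_half_pow_natAbs_le (K : Finset ℤ) (j : ℤ) :
    ∑ k ∈ K, (1 / 2 : ℝ) ^ (k - j).natAbs ≤ 4 := by
  rw [← Finset.sum_filter_add_sum_filter_not K (fun k => j ≤ k)]
  have h1 : ∑ k ∈ K.filter (fun k => j ≤ k), (1 / 2 : ℝ) ^ (k - j).natAbs ≤ 2 := by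
    refine sum_half_pow_le_two fun a ha b hb hab => ?_
    simp only [Finset.coe_filter, Set.mem_ofPred_eq] at ha hb hab
    omega
  have h2 : ∑ k ∈ K.filter (fun k => ¬ j ≤ k), (1 / 2 : ℝ) ^ (k - j).natAbs ≤ 2 := by
    refine sum_half_pow_le_two fun a ha b hb hab => ?_
    simp only [Finset.coe_filter, Set.mem_ofPred_eq] at ha hb hab
    omega
  linarith

/-- A form of Schur's test for a kernel that decays geometrically off the diagonal. -/
lemma sum_half_pow_natAbs_mul_add_le (K : Finset ℤ) {a : ℤ → ℝ} (ha : ∀ k, 0 ≤ a k) :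
    ∑ j ∈ K, ∑ k ∈ K, (1 / 2 : ℝ) ^ (k - j).natAbs * (a j + a k) ≤ 8 * ∑ k ∈ K, a k := by
  have h1 : ∑ j ∈ K, ∑ k ∈ K, (1 / 2 : ℝ) ^ (k - j).natAbs * a j ≤ 4 * ∑ k ∈ K, a k := by
    rw [Finset.mul_sum]
    refine Finset.sum_le_sum fun j _ => ?_
    rw [← Finset.sum_mul]
    exact mul_le_mul_of_nonneg_right (sum_half_pow_natAbs_le K j) (ha j)
  have h2 : ∑ j ∈ K, ∑ k ∈ K, (1 / 2 : ℝ) ^ (k - j).natAbs * a k ≤ 4 * ∑ k ∈ K, a k := by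
    rw [Finset.sum_comm]
    refine le_trans (le_of_eq ?_) h1
    refine Finset.sum_congr rfl fun j _ => Finset.sum_congr rfl fun k _ => ?_
    rw [← Int.natAbs_neg, neg_sub]
  simp only [mul_add, Finset.sum_add_distrib]
  linarith

variable {X Y : Type*} [Preorder X] [Preorder Y] [Fintype X] [Fintype Y]

lemma zpow_mul_biEnergy_le (hX : UpTotal X) (hY : UpTotal Y) {μ : X → Y → ℝ}
    (hμ : ∀ x y, 0 ≤ μ x y) {C : ℝ} (hC : 1 ≤ C)
    (hR : ∀ E, biEnergy μ E E ≤ C * biMass μ E) (E : ℤ → X → Y → Prop) (j k : ℤ) :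
    (16 : ℝ) ^ j * 16 ^ k * biEnergy μ (E j) (E k) ≤
      6 * C ^ 2 * ((1 / 2 : ℝ) ^ (k - j).natAbs * (((16 : ℝ) ^ j) ^ 2 * biMass μ (E j) +
        ((16 : ℝ) ^ k) ^ 2 * biMass μ (E k))) := by
  have main : ∀ j k : ℤ, j ≤ k → (16 : ℝ) ^ j * 16 ^ k * biEnergy μ (E j) (E k) ≤
      6 * C ^ 2 * ((1 / 2 : ℝ) ^ (k - j).natAbs * (((16 : ℝ) ^ j) ^ 2 * biMass μ (E j) +
        ((16 : ℝ) ^ k) ^ 2 * biMass μ (E k))) := by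
    intro j k hjk
    obtain ⟨m, rfl⟩ := Int.le.dest hjk
    have e1 : (16 : ℝ) ^ (j + (m : ℤ)) = 16 ^ j * ((2 : ℝ) ^ m) ^ 4 := by
      rw [zpow_add₀ (by norm_num), zpow_natCast, ← pow_mul, mul_comm m 4, pow_mul]
      norm_num
    have e2 : (j + (m : ℤ) - j).natAbs = m := by omega
    -- Base 16 for the levels is `2⁴`: a gap of `m` levels is a weight ratio `r⁴` with `r = 2^m`,
    -- hence decay `2^(-m)`.
    have h := mul_biEnergy_le hX hY hμ hC hR (E j) (E (j + m)) (r := (2 : ℝ) ^ m)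
      (s := (16 : ℝ) ^ j) (one_le_pow₀ (by norm_num)) (by positivity)
    rw [e1, e2]
    refine h.trans (le_of_eq ?_)
    rw [one_div, inv_pow]
    ring
  rcases le_total j k with h | h
  · exact main j k h
  · have := main k j h
    rw [biEnergy_comm, ← Int.natAbs_neg, neg_sub] at this
    rw [mul_comm ((16 : ℝ) ^ j), add_comm (((16 : ℝ) ^ j) ^ 2 * _)]
    exact this

lemma biDownSum_sum_mul (K : Finset ℤ) (c : ℤ → ℝ) (g : ℤ → X → Y → ℝ) (x : X) (y : Y) :
    biDownSum (fun a b => ∑ k ∈ K, c k * g k a b) x y = ∑ k ∈ K, c k * biDownSum (g k) x y := by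
  simp only [biDownSum, Finset.mul_sum]
  rw [Finset.sum_comm]
  rw [Finset.sum_comm (s := K)]
  rw [Finset.sum_comm]
  refine Finset.sum_congr rfl fun a _ => ?_
  rw [Finset.sum_comm]
  exact Finset.sum_congr rfl fun k _ => Finset.sum_congr rfl fun b _ => by ring

/-- The restricted energy condition implies its version for densities. -/
theorem sum_sq_biDownSum_mul_le (hX : UpTotal X) (hY : UpTotal Y) {μ : X → Y → ℝ}
    (hμ : ∀ x y, 0 ≤ μ x y) {C : ℝ} (hC : 1 ≤ C)
    (hR : ∀ E, biEnergy μ E E ≤ C * biMass μ E) {ψ : X → Y → ℝ} (hψ : ∀ x y, 0 ≤ ψ x y) :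
    ∑ x, ∑ y, biDownSum (fun a b => ψ a b * μ a b) x y ^ 2 ≤
      12288 * C ^ 2 * ∑ x, ∑ y, ψ x y ^ 2 * μ x y := by
  classical
  set L : X → Y → ℤ := fun x y => Int.log 16 (ψ x y)
  set K : Finset ℤ := Finset.univ.image fun p : X × Y => L p.1 p.2
  -- Positivity is required because `Int.log` returns the default value `0` at `ψ = 0`.
  set E : ℤ → X → Y → Prop := fun k x y => 0 < ψ x y ∧ L x y = k
  have hK : ∀ x y, L x y ∈ K := fun x y => Finset.mem_image.2 ⟨(x, y), Finset.mem_univ _, rfl⟩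
  have hsum : ∀ (c : ℤ → ℝ) x y, ∑ k ∈ K, c k * biRestrict μ (E k) x y =
      if 0 < ψ x y then c (L x y) * μ x y else 0 := by
    intro c x y
    rw [Finset.sum_eq_single_of_mem (L x y) (hK x y)]
    · by_cases h : 0 < ψ x y <;> simp [biRestrict, E, h]
    · intro k _ hk
      simp [biRestrict, E, hk.symm]
  have hup : ∀ x y, ψ x y * μ x y ≤ ∑ k ∈ K, (16 * (16 : ℝ) ^ k) * biRestrict μ (E k) x y := by
    intro x y
    rw [hsum]
    split_ifs with h
    · refine mul_le_mul_of_nonneg_right ?_ (hμ x y)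
      have := (Int.lt_zpow_succ_log_self (b := 16) (by norm_num) (ψ x y)).le
      rw [zpow_add_one₀ (by norm_num)] at this
      rw [mul_comm]
      exact_mod_cast this
    · have : ψ x y = 0 := le_antisymm (not_lt.1 h) (hψ x y)
      simp [this]
  have hlow : ∑ k ∈ K, ((16 : ℝ) ^ k) ^ 2 * biMass μ (E k) ≤ ∑ x, ∑ y, ψ x y ^ 2 * μ x y := by
    simp only [biMass, Finset.mul_sum]
    rw [Finset.sum_comm]
    refine Finset.sum_le_sum fun x _ => ?_
    rw [Finset.sum_comm]
    refine Finset.sum_le_sum fun y _ => ?_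
    rw [hsum (fun k => ((16 : ℝ) ^ k) ^ 2)]
    split_ifs with h
    · refine mul_le_mul_of_nonneg_right (pow_le_pow_left₀ (by positivity) ?_ 2) (hμ x y)
      exact_mod_cast Int.zpow_log_le_self (b := 16) (by norm_num) h
    · exact mul_nonneg (sq_nonneg _) (hμ x y)
  -- The factor `256 = 16²` is the loss from rounding `ψ` up to the next power of 16; with `6 * C ^
  -- 2` from the decay and `8` from Schur's test it gives `12288 * C ^ 2`.
  have hpt : ∀ x y, biDownSum (fun a b => ψ a b * μ a b) x y ^ 2 ≤
      256 * ∑ j ∈ K, ∑ k ∈ K, (16 : ℝ) ^ j * 16 ^ k *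
        (biDownSum (biRestrict μ (E j)) x y * biDownSum (biRestrict μ (E k)) x y) := by
    intro x y
    refine (pow_le_pow_left₀ (biDownSum_nonneg (fun a b => mul_nonneg (hψ a b) (hμ a b)) x y)
      (biDownSum_mono hup x y) 2).trans (le_of_eq ?_)
    rw [biDownSum_sum_mul, sq, Finset.sum_mul_sum, Finset.mul_sum]
    refine Finset.sum_congr rfl fun j _ => ?_
    rw [Finset.mul_sum]
    exact Finset.sum_congr rfl fun k _ => by ring
  calc ∑ x, ∑ y, biDownSum (fun a b => ψ a b * μ a b) x y ^ 2
      ≤ ∑ x, ∑ y, 256 * ∑ j ∈ K, ∑ k ∈ K, (16 : ℝ) ^ j * 16 ^ k *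
        (biDownSum (biRestrict μ (E j)) x y * biDownSum (biRestrict μ (E k)) x y) :=
        Finset.sum_le_sum fun x _ => Finset.sum_le_sum fun y _ => hpt x y
    _ = 256 * ∑ j ∈ K, ∑ k ∈ K, (16 : ℝ) ^ j * 16 ^ k * biEnergy μ (E j) (E k) := by
        simp only [biEnergy, Finset.mul_sum]
        exact sum_sum_sum_sum_comm _ _ _ _ _
    _ ≤ 256 * ∑ j ∈ K, ∑ k ∈ K, 6 * C ^ 2 * ((1 / 2 : ℝ) ^ (k - j).natAbs *
        (((16 : ℝ) ^ j) ^ 2 * biMass μ (E j) + ((16 : ℝ) ^ k) ^ 2 * biMass μ (E k))) :=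
        mul_le_mul_of_nonneg_left (Finset.sum_le_sum fun j _ => Finset.sum_le_sum fun k _ =>
          zpow_mul_biEnergy_le hX hY hμ hC hR E j k) (by norm_num)
    _ = 1536 * C ^ 2 * ∑ j ∈ K, ∑ k ∈ K, (1 / 2 : ℝ) ^ (k - j).natAbs *
        (((16 : ℝ) ^ j) ^ 2 * biMass μ (E j) + ((16 : ℝ) ^ k) ^ 2 * biMass μ (E k)) := by
        simp only [← Finset.mul_sum]
        ring
    _ ≤ 1536 * C ^ 2 * (8 * ∑ k ∈ K, ((16 : ℝ) ^ k) ^ 2 * biMass μ (E k)) :=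
        mul_le_mul_of_nonneg_left (sum_half_pow_natAbs_mul_add_le K
          (a := fun k => ((16 : ℝ) ^ k) ^ 2 * biMass μ (E k))
          fun k => mul_nonneg (sq_nonneg _) (biMass_nonneg hμ (E k))) (by positivity)
    _ ≤ 1536 * C ^ 2 * (8 * ∑ x, ∑ y, ψ x y ^ 2 * μ x y) := by gcongr
    _ = 12288 * C ^ 2 * ∑ x, ∑ y, ψ x y ^ 2 * μ x y := by ring

/-- The restricted energy condition implies the embedding on the product of two preorders. -/
theorem sum_sq_biUpSum_mul_le (hX : UpTotal X) (hY : UpTotal Y) {μ : X → Y → ℝ}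
    (hμ : ∀ x y, 0 ≤ μ x y) {C : ℝ} (hC : 1 ≤ C)
    (hR : ∀ E, biEnergy μ E E ≤ C * biMass μ E) (φ : X → Y → ℝ) :
    ∑ x, ∑ y, biUpSum φ x y ^ 2 * μ x y ≤ 12288 * C ^ 2 * ∑ x, ∑ y, φ x y ^ 2 := by
  set φ' : X → Y → ℝ := fun x y => |φ x y|
  have hφ' : ∀ x y, 0 ≤ φ' x y := fun x y => abs_nonneg _
  set ψ := biUpSum φ' with hψdef
  have hψ : ∀ x y, 0 ≤ ψ x y := biUpSum_nonneg hφ'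
  have habs : ∀ x y, |biUpSum φ x y| ≤ ψ x y := by
    intro x y
    rw [abs_le]
    have e : -ψ x y = biUpSum (fun a b => -φ' a b) x y := by
      simp only [hψdef, biUpSum, mul_neg, Finset.sum_neg_distrib]
    rw [e]
    exact ⟨biUpSum_mono (fun a b => neg_abs_le _) x y, biUpSum_mono (fun a b => le_abs_self _) x y⟩
  set A := ∑ x, ∑ y, ψ x y ^ 2 * μ x y with hA
  set Φ := ∑ x, ∑ y, φ x y ^ 2 with hΦ
  have hA0 : 0 ≤ A := Finset.sum_nonneg fun x _ => Finset.sum_nonneg fun y _ =>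
    mul_nonneg (sq_nonneg _) (hμ x y)
  have hΦ0 : 0 ≤ Φ := Finset.sum_nonneg fun x _ => Finset.sum_nonneg fun y _ => sq_nonneg _
  have h1 : ∑ x, ∑ y, biUpSum φ x y ^ 2 * μ x y ≤ A :=
    Finset.sum_le_sum fun x _ => Finset.sum_le_sum fun y _ =>
      mul_le_mul_of_nonneg_right (sq_le_sq.2 ((habs x y).trans (le_abs_self _))) (hμ x y)
  -- Duality, with the potential `ψ` of `|φ|` itself as the density; the bound for densities then
  -- returns `A` under the square root.
  have h2 : A = ∑ x, ∑ y, φ' x y * biDownSum (fun a b => ψ a b * μ a b) x y := by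
    rw [← sum_biUpSum_mul]
    exact Finset.sum_congr rfl fun x _ => Finset.sum_congr rfl fun y _ => by ring
  have h3 := sum_mul_le_sqrt_mul_sqrt φ' (biDownSum fun a b => ψ a b * μ a b)
  rw [← h2] at h3
  have h4 : ∑ x, ∑ y, φ' x y ^ 2 = Φ := by simp only [φ', sq_abs, hΦ]
  rw [h4, ← Real.sqrt_mul hΦ0] at h3
  refine h1.trans (le_of_le_sqrt_mul hA0 (mul_nonneg (by positivity) hΦ0) (h3.trans ?_))
  refine Real.sqrt_le_sqrt ((mul_le_mul_of_nonneg_left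
      (sum_sq_biDownSum_mul_le hX hY hμ hC hR hψ) hΦ0).trans (le_of_eq ?_))
  rw [← hA]
  ring

/-- The embedding implies the restricted energy condition on the product of two preorders. -/
theorem biEnergy_le_of_embedding {μ : X → Y → ℝ} (hμ : ∀ x y, 0 ≤ μ x y) {C : ℝ} (hC : 0 ≤ C)
    (hE : ∀ φ : X → Y → ℝ, ∑ x, ∑ y, biUpSum φ x y ^ 2 * μ x y ≤ C * ∑ x, ∑ y, φ x y ^ 2)
    (E : X → Y → Prop) : biEnergy μ E E ≤ C * biMass μ E := by
  classical
  set ν := biRestrict μ E with hν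
  have hν0 : ∀ x y, 0 ≤ ν x y := biRestrict_nonneg hμ E
  have hνμ : ∀ x y, ν x y ≤ μ x y := by
    intro x y
    simp only [hν, biRestrict]
    split_ifs
    · exact le_rfl
    · exact hμ x y
  set D := biEnergy μ E E with hD
  have hDsq : D = ∑ x, ∑ y, biDownSum ν x y ^ 2 := biEnergy_self μ E
  have hD0 : 0 ≤ D := by
    rw [hDsq]
    exact Finset.sum_nonneg fun x _ => Finset.sum_nonneg fun y _ => sq_nonneg _
  -- The energy is the integral of the potential of `ν`; Cauchy–Schwarz in `ν`, then the embedding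
  -- tested on `I*ν`, bounds it by `√(C D · μ(E))`.
  have h1 : D = ∑ x, ∑ y, (biUpSum (biDownSum ν) x y * √(ν x y)) * √(ν x y) := by
    have : D = ∑ x, ∑ y, biUpSum (biDownSum ν) x y * ν x y := by
      rw [sum_biUpSum_mul]; rfl
    rw [this]
    refine Finset.sum_congr rfl fun x _ => Finset.sum_congr rfl fun y _ => ?_
    rw [mul_assoc, Real.mul_self_sqrt (hν0 x y)]
  have h2 := sum_mul_le_sqrt_mul_sqrt
    (fun x y => biUpSum (biDownSum ν) x y * √(ν x y)) (fun x y => √(ν x y))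
  rw [← h1] at h2
  simp only [mul_pow, Real.sq_sqrt (hν0 _ _)] at h2
  have h3 : ∑ x, ∑ y, biUpSum (biDownSum ν) x y ^ 2 * ν x y ≤ C * D := by
    rw [hDsq]
    refine le_trans ?_ (hE (biDownSum ν))
    exact Finset.sum_le_sum fun x _ => Finset.sum_le_sum fun y _ =>
      mul_le_mul_of_nonneg_left (hνμ x y) (sq_nonneg _)
  have hM : ∑ x, ∑ y, ν x y = biMass μ E := rfl
  have hM0 := biMass_nonneg hμ E
  rw [hM] at h2
  have h4 := h2.trans (mul_le_mul_of_nonneg_right (Real.sqrt_le_sqrt h3) (Real.sqrt_nonneg _))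
  rw [← Real.sqrt_mul (mul_nonneg hC hD0), mul_right_comm] at h4
  exact le_of_le_sqrt_mul hD0 (mul_nonneg hC hM0) h4

end DyadicLevels

/-! ### Transfer to the dyadic bi-tree. -/

section BiTree

lemma ite_zero_congr {p q : Prop} {hp : Decidable p} {hq : Decidable q} (h : p ↔ q) (a : ℝ) :
    (if p then a else 0) = if q then a else 0 := if_congr h rfl rfl

/-- The order of the dyadic tree: `a ≤ b` if the interval of `a` is contained in that of `b`. -/
noncomputable instance DyadicTree.instPreorder (N : ℕ) : Preorder (DyadicTree N) :=
  Preorder.lift DyadicTree.interval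

namespace DyadicTree

variable {N : ℕ}

lemma le_def (a b : DyadicTree N) : a ≤ b ↔ a.interval ⊆ b.interval := Iff.rfl

lemma left_lt_right (a : DyadicTree N) :
    (a.index : ℝ) / 2 ^ a.level < ((a.index : ℝ) + 1) / 2 ^ a.level :=
  div_lt_div_of_pos_right (lt_add_one _) (by positivity)

lemma interval_nonempty (a : DyadicTree N) : a.interval.Nonempty :=
  Set.nonempty_Icc.2 a.left_lt_right.le

lemma le_iff (a b : DyadicTree N) : a ≤ b ↔
    (b.index : ℝ) / 2 ^ b.level ≤ (a.index : ℝ) / 2 ^ a.level ∧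
      ((a.index : ℝ) + 1) / 2 ^ a.level ≤ ((b.index : ℝ) + 1) / 2 ^ b.level := by
  rw [le_def, interval, interval, Set.Icc_subset_Icc_iff a.left_lt_right.le]

/-- Two dyadic intervals sharing an interval of positive length are nested. The strict length of `w`
excludes intervals that merely touch; after clearing denominators the claim is about integers. -/
lemma le_of_level_le {w a b : DyadicTree N} (ha : w ≤ a) (hb : w ≤ b)
    (h : a.level ≤ b.level) : b ≤ a := by
  rw [le_iff] at ha hb ⊢
  have hw := w.left_lt_right
  obtain ⟨d, hd⟩ := Nat.exists_eq_add_of_le h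
  have h1 := (ha.1.trans_lt hw).trans_le hb.2
  have h2 := (hb.1.trans_lt hw).trans_le ha.2
  have hA : (0 : ℝ) < 2 ^ a.level := by positivity
  have hD : (0 : ℝ) < 2 ^ d := by positivity
  rw [hd, pow_add] at h1 h2 ⊢
  rw [div_lt_div_iff₀ (by positivity) (by positivity), mul_comm ((2 : ℝ) ^ a.level), ← mul_assoc,
    mul_lt_mul_iff_left₀ hA] at h1 h2
  rw [div_le_div_iff₀ (by positivity) (by positivity),
    div_le_div_iff₀ (by positivity) (by positivity), mul_comm ((2 : ℝ) ^ a.level), ← mul_assoc,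
    ← mul_assoc, mul_le_mul_iff_left₀ hA, mul_le_mul_iff_left₀ hA]
  norm_cast at h1 h2 ⊢
  omega

lemma upTotal (N : ℕ) : UpTotal (DyadicTree N) := fun _ a b ha hb =>
  (le_total a.level b.level).elim (fun h => Or.inr (le_of_level_le ha hb h))
    fun h => Or.inl (le_of_level_le hb ha h)

end DyadicTree

namespace BiTree

variable {N : ℕ}

lemma le_iff (α β : BiTree N) : α ≤ β ↔ α.1 ≤ β.1 ∧ α.2 ≤ β.2 := by
  change α.1.interval ×ˢ α.2.interval ⊆ β.1.interval ×ˢ β.2.interval ↔ _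
  rw [Set.prod_subset_prod_iff]
  simp [DyadicTree.le_def, α.1.interval_nonempty.ne_empty, α.2.interval_nonempty.ne_empty]

lemma sum_eq (F : BiTree N → ℝ) : ∑ α, F α = ∑ x, ∑ y, F (x, y) :=
  Fintype.sum_prod_type (α₁ := DyadicTree N) (α₂ := DyadicTree N) F

lemma hardy_eq (φ : BiTree N → ℝ) (x y : DyadicTree N) :
    hardy φ (x, y) = biUpSum (fun a b => φ (a, b)) x y := by
  unfold hardy biUpSum zetaKernel
  rw [Finset.sum_filter, sum_eq]
  refine Finset.sum_congr rfl fun a _ => Finset.sum_congr rfl fun b _ => ?_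
  refine (ite_zero_congr (hq := Classical.dec _) (le_iff (x, y) (a, b)) _).trans ?_
  by_cases h1 : x ≤ a <;> by_cases h2 : y ≤ b <;> simp [h1, h2]

lemma hardyDual_eq (φ : BiTree N → ℝ) (x y : DyadicTree N) :
    hardyDual φ (x, y) = biDownSum (fun a b => φ (a, b)) x y := by
  unfold hardyDual biDownSum zetaKernel
  rw [Finset.sum_filter, sum_eq]
  refine Finset.sum_congr rfl fun a _ => Finset.sum_congr rfl fun b _ => ?_
  refine (ite_zero_congr (hq := Classical.dec _) (le_iff (a, b) (x, y)) _).trans ?_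
  by_cases h1 : a ≤ x <;> by_cases h2 : b ≤ y <;> simp [h1, h2]

end BiTree

namespace BoundaryMeasure

variable {N : ℕ} (μ : BoundaryMeasure N)

/-- The mass function of a boundary measure as a function of two variables. -/
noncomputable def biMassFun (x y : DyadicTree N) : ℝ := μ.mass (x, y)

lemma biMassFun_nonneg (x y : DyadicTree N) : 0 ≤ μ.biMassFun x y := μ.mass_nonneg _

lemma sum_boundary_mul_mass (F : BiTree N → ℝ) :
    ∑ ω ∈ BiTree.boundary N, F ω * μ.mass ω = ∑ x, ∑ y, F (x, y) * μ.biMassFun x y := by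
  rw [Finset.sum_subset (Finset.subset_univ _) fun ω _ hω => by rw [μ.mass_eq_zero ω hω, mul_zero],
    BiTree.sum_eq]
  rfl

lemma embedding_iff (C : ℝ) : μ.Embedding C ↔ ∀ φ : DyadicTree N → DyadicTree N → ℝ,
    ∑ x, ∑ y, biUpSum φ x y ^ 2 * μ.biMassFun x y ≤ C * ∑ x, ∑ y, φ x y ^ 2 := by
  have key : ∀ φ : BiTree N → ℝ, (∑ ω ∈ BiTree.boundary N, |BiTree.hardy φ ω| ^ 2 * μ.mass ω ≤
      C * BiTree.normSq φ) ↔ ∑ x, ∑ y, biUpSum (fun a b => φ (a, b)) x y ^ 2 * μ.biMassFun x y ≤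
      C * ∑ x, ∑ y, φ (x, y) ^ 2 := by
    intro φ
    rw [sum_boundary_mul_mass, BiTree.normSq, BiTree.sum_eq]
    simp only [sq_abs, BiTree.hardy_eq]
  exact ⟨fun h φ => (key fun α => φ α.1 α.2).1 (h _), fun h φ => (key φ).2 (h _)⟩

lemma energy_restrict_eq (E : Finset (BiTree N)) :
    (μ.restrict E).energy = biEnergy μ.biMassFun (fun x y => ((x, y) : BiTree N) ∈ E)
      (fun x y => ((x, y) : BiTree N) ∈ E) := by
  rw [energy, BiTree.sum_eq, biEnergy_self]
  refine Finset.sum_congr rfl fun x _ => Finset.sum_congr rfl fun y _ => ?_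
  have e : (μ.restrict E).rectMass (x, y) = biDownSum (fun a b => (μ.restrict E).mass (a, b)) x y :=
    BiTree.hardyDual_eq _ x y
  have e' : (fun a b => (μ.restrict E).mass (a, b)) =
      biRestrict μ.biMassFun (fun x y => ((x, y) : BiTree N) ∈ E) := by
    funext a b
    exact ite_zero_congr Iff.rfl _
  rw [e, e']

lemma measure_eq (E : Finset (BiTree N)) :
    μ.measure E = biMass μ.biMassFun (fun x y => ((x, y) : BiTree N) ∈ E) := by
  classical
  rw [measure, biMass]
  have : ∑ ω ∈ E, μ.mass ω = ∑ ω, if ω ∈ E then μ.mass ω else 0 := by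
    rw [← Finset.sum_filter]; simp
  rw [this, BiTree.sum_eq]
  refine Finset.sum_congr rfl fun x _ => Finset.sum_congr rfl fun y _ => ?_
  exact ite_zero_congr Iff.rfl _

/-- Sets of arbitrary pairs may replace subsets of the boundary because the mass vanishes off the
boundary. -/
lemma restrictedEnergy_iff (C : ℝ) : μ.RestrictedEnergy C ↔
    ∀ E, biEnergy μ.biMassFun E E ≤ C * biMass μ.biMassFun E := by
  classical
  constructor
  · intro h E
    set E' : Finset (BiTree N) := (BiTree.boundary N).filter fun ω => E ω.1 ω.2
    have h1 := h E' (Finset.filter_subset _ _)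
    rw [energy_restrict_eq, measure_eq] at h1
    have e : biRestrict μ.biMassFun (fun x y => ((x, y) : BiTree N) ∈ E') =
        biRestrict μ.biMassFun E := by
      funext x y
      by_cases hb : ((x, y) : BiTree N) ∈ BiTree.boundary N
      · exact ite_zero_congr (Finset.mem_filter.trans (and_iff_right hb)) _
      · have h0 : μ.biMassFun x y = 0 := μ.mass_eq_zero _ hb
        simp only [biRestrict, h0, ite_self]
    simpa only [biEnergy, biMass, e] using h1
  · intro h E hE
    rw [energy_restrict_eq, measure_eq]
    exact h _

end BoundaryMeasure

end BiTree

theorem theorem1p3 :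
    (∀ C : ℝ, ∃ C₁ : ℝ, ∀ (N : ℕ) (μ : BoundaryMeasure N),
      μ.RestrictedEnergy C → μ.Embedding C₁) ∧
    (∀ (C : ℝ) (N : ℕ) (μ : BoundaryMeasure N),
      μ.Embedding C → μ.RestrictedEnergy C) := by
  constructor
  · intro C
    -- The abstract estimate assumes a constant at least 1; raising `C` only weakens the condition.
    refine ⟨12288 * max C 1 ^ 2, fun N μ h => ?_⟩
    rw [μ.restrictedEnergy_iff] at h
    rw [μ.embedding_iff]
    exact sum_sq_biUpSum_mul_le (DyadicTree.upTotal N) (DyadicTree.upTotal N) μ.biMassFun_nonneg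
      (le_max_right C 1) fun E => (h E).trans
        (mul_le_mul_of_nonneg_right (le_max_left C 1) (biMass_nonneg μ.biMassFun_nonneg E))
  · intro C N μ h
    rw [μ.embedding_iff] at h
    rw [μ.restrictedEnergy_iff]
    have root : DyadicTree N := ⟨0, ⟨0, by positivity⟩⟩
    have hpos : (0 : ℝ) < ∑ _x : DyadicTree N, ∑ _y : DyadicTree N, (1 : ℝ) ^ 2 :=
      Finset.sum_pos (fun _ _ => Finset.sum_pos (fun _ _ => by norm_num) ⟨root, Finset.mem_univ _⟩)
        ⟨root, Finset.mem_univ _⟩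
    -- Testing on the constant function 1, whose norm is positive since the tree has a root, rules
    -- out negative `C`.
    have hC : 0 ≤ C := by
      refine nonneg_of_mul_nonneg_left (le_trans ?_ (h fun _ _ => 1)) hpos
      exact Finset.sum_nonneg fun x _ => Finset.sum_nonneg fun y _ =>
        mul_nonneg (sq_nonneg _) (μ.biMassFun_nonneg x y)
    exact biEnergy_le_of_embedding μ.biMassFun_nonneg hC h
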